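/- Let $n,k\ge 0$ be integers, let $M$ be a smooth $n$-dimensional manifold without boundary (Hausdorff and second countable), and let $F:M\times(-\infty,0)\to\mathbb{R}^{n+k}$ be a smooth solution of the mean curvature flow: $F$ is smooth, each $F_t=F(\cdot,t)$ is an immersion, and $$\frac{\partial F}{\partial t}(p,t)=H(p,t)\qquad (p\in M,\ t<0),$$ where $H=\sum_{i,j}g^{ij}h_{ij}$ is the mean curvature vector of $F_t$, i.e. the trace, with respect to the induced metric $g_{ij}=\langle\partial_iF_t,\partial_jF_t\rangle$, of the second fundamental form $h_{ij}=(\partial_i\partial_jF_t)^\perp$. Here $v^\perp$ denotes the component of $v\in\mathbb{R}^{n+k}$ orthogonal to $dF_t(T_pM)$. Assume that every $F_t:M\to\mathbb{R}^{n+k}$ is proper (this holds automatically if $M$ is closed). Then the following three statements are equivalent: 1. $F$ is self-similar: $F_t(M)=\sqrt{-t}\,F_{-1}(M)$ for all $t<0$; 2. $F$ is self-similar up to reparametrisation: there are diffeomorphisms $\phi(\cdot,t):M\to M$, $t<0$, with $\phi$ smooth on $M\times(-\infty,0)$, such that $F(p,t)=\sqrt{-t}\,F(\phi(p,t),-1)$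 for all $p\in M$ and $t<0$; 3. $H(p,t)=\dfrac{1}{2t}\,F^\perp(p,t)$ for all $p\in M$ and $t<0$. -/

import Mathlib

open Set
open scoped Manifold ContDiff

noncomputable section

namespace MCF

variable {n N : ℕ} {M : Type*} [TopologicalSpace M] [ChartedSpace (EuclideanSpace ℝ (Fin n)) M]

/-- The differential at `p` of a map `f : M → ℝ^N`. A tangent vector at `p` is written in the
preferred chart at `p`, as always in Mathlib. -/
def differential (f : M → EuclideanSpace ℝ (Fin N)) (p : M) :
    EuclideanSpace ℝ (Fin n) →L[ℝ] EuclideanSpace ℝ (Fin N) :=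
  mfderiv (𝓡 n) (𝓡 N) f p

/-- The component `v^⊥` of a vector `v` of the ambient space that is normal to the immersion `f`
at `p`: the orthogonal projection of `v` to the orthogonal complement of `df_p (T_p M)`. -/
def normalPart (f : M → EuclideanSpace ℝ (Fin N)) (p : M) (v : EuclideanSpace ℝ (Fin N)) :
    EuclideanSpace ℝ (Fin N) :=
  (LinearMap.range (differential (n := n) f p).toLinearMap)ᗮ.starProjection v

/-- The `i`-th coordinate vector `∂_i`. -/
def coordVec (i : Fin n) : EuclideanSpace ℝ (Fin n) := EuclideanSpace.single i 1

/-- The matrix `g_ij = ⟨∂_i f, ∂_j f⟩` of the induced metric at `p`, in the preferred chart at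
`p`. -/
def metricMatrix (f : M → EuclideanSpace ℝ (Fin N)) (p : M) : Matrix (Fin n) (Fin n) ℝ :=
  Matrix.of fun i j =>
    inner ℝ (differential (n := n) f p (coordVec i)) (differential (n := n) f p (coordVec j))

/-- The map `f` read in the preferred chart at `p`. -/
def localRep (f : M → EuclideanSpace ℝ (Fin N)) (p : M) :
    EuclideanSpace ℝ (Fin n) → EuclideanSpace ℝ (Fin N) :=
  f ∘ (extChartAt (𝓡 n) p).symm

/-- The coefficient `h_ij = (∂_i ∂_j f)^⊥` at `p` of the (normal-bundle-valued) second fundamental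
form of `f`, in the preferred chart at `p`. -/
def secondFundamentalForm (f : M → EuclideanSpace ℝ (Fin N)) (p : M) (i j : Fin n) :
    EuclideanSpace ℝ (Fin N) :=
  normalPart (n := n) f p
    (fderiv ℝ (fun x => fderiv ℝ (localRep (n := n) f p) x (coordVec j))
      (extChartAt (𝓡 n) p p) (coordVec i))

/-- The mean curvature vector `H = ∑_{i,j} g^{ij} h_ij` of the immersion `f` at `p`. -/
def meanCurvature (f : M → EuclideanSpace ℝ (Fin N)) (p : M) : EuclideanSpace ℝ (Fin N) :=
  ∑ i : Fin n, ∑ j : Fin n, (metricMatrix f p)⁻¹ i j • secondFundamentalForm f p i j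

/-- `F : M × (-∞, 0) → ℝ^N` is a (smooth) solution of the mean curvature flow: a smooth
time-dependent family of immersions `F_t` with `∂F/∂t = H`. Values `F p t` with `0 ≤ t` are
irrelevant. -/
structure IsMeanCurvatureFlow (n : ℕ) {N : ℕ} {M : Type*} [TopologicalSpace M]
    [ChartedSpace (EuclideanSpace ℝ (Fin n)) M] (F : M → ℝ → EuclideanSpace ℝ (Fin N)) :
    Prop where
  smooth : ContMDiffOn ((𝓡 n).prod 𝓘(ℝ, ℝ)) (𝓡 N) ∞ (fun q : M × ℝ => F q.1 q.2)
    (univ ×ˢ Iio 0)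
  immersion : ∀ t < 0, ∀ p : M, Function.Injective (differential (n := n) (fun q => F q t) p)
  flow : ∀ t < 0, ∀ p : M,
    HasDerivAt (fun s => F p s) (meanCurvature (n := n) (fun q => F q t) p) t

/-- The images move by scaling: `F_t(M) = √(-t) F_{-1}(M)` for all `t < 0`. -/
def ImageSelfSimilar {N : ℕ} {M : Type*} (F : M → ℝ → EuclideanSpace ℝ (Fin N)) : Prop :=
  ∀ t < 0, range (fun p => F p t) = (fun x => √(-t) • x) '' range (fun p => F p (-1))

/-- The flow moves by scaling up to reparametrisation: `F(p, t) = √(-t) F(φ(p, t), -1)` for a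
smooth time-dependent family `φ(·, t)`, `t < 0`, of diffeomorphisms of `M`. -/
def ParamSelfSimilar (n : ℕ) {N : ℕ} {M : Type*} [TopologicalSpace M]
    [ChartedSpace (EuclideanSpace ℝ (Fin n)) M] (F : M → ℝ → EuclideanSpace ℝ (Fin N)) : Prop :=
  ∃ φ : ℝ → (M ≃ₘ⟮𝓡 n, 𝓡 n⟯ M),
    ContMDiffOn ((𝓡 n).prod 𝓘(ℝ, ℝ)) (𝓡 n) ∞ (fun q : M × ℝ => φ q.2 q.1) (univ ×ˢ Iio 0) ∧
    ∀ t < 0, ∀ p : M, F p t = √(-t) • F (φ t p) (-1)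

end MCF

end

/-! Put `t = -exp (-τ)` and rescale: `G τ = exp (τ/2) • F (-exp (-τ))`. Then `∂G/∂τ = exp (τ/2) •
(F/2 - t H)`. As `H` is normal, this velocity is tangential exactly when `H = F^⊥/(2t)`, so the
shrinker equation says that `G` moves tangentially (`isTangential_rescaledFlow_iff`). Statement 1
says that the image of `G τ` is constant, statement 2 that `G` is stationary up to diffeomorphisms,
and 2 implies 1 at once.

1 implies 3 by dimension (`isTangential_of_range_eq`). Were the velocity not tangential at some
point, the map `(p, τ) ↦ G p τ` would be an immersion there, and the common image would have
Hausdorff dimension at least `n + 1`. But that image is a countable union of locally Lipschitz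
images of subsets of `ℝ^n`. This needs no embeddedness.

3 implies 2 by transport along the level curves of `G` in spacetime. Tangential motion makes the
level sets local graphs over the time axis (`exists_levelCurves`). For a tangential velocity `d`,
pairing with `d` kills the curvature term and gives `‖d‖ ≤ ‖G‖/2`; Gronwall and properness then make
the level sets compact over compact time intervals (`isCompact_levelSet`). Hence level curves never
escape, and transport `T` is global and continuous (`exists_transport`). It is smooth because it is
a continuous lift of a smooth map through an immersion (`contMDiffAt_of_comp_immersion`), and
transport to `τ = 0` is the required reparametrisation. -/

noncomputable section

namespace MCF

open Filter Topology Module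

/-! ### Local analysis in vector spaces: immersions and straightening of tangential motion. -/

section Flat

variable {E H : Type*} [NormedAddCommGroup E] [NormedSpace ℝ E] [FiniteDimensional ℝ E]
  [NormedAddCommGroup H] [NormedSpace ℝ H] [FiniteDimensional ℝ H]

/-- An injective linear map between finite-dimensional spaces has a continuous left inverse. -/
theorem exists_clm_leftInverse {E H : Type*} [NormedAddCommGroup E] [NormedSpace ℝ E]
    [NormedAddCommGroup H] [NormedSpace ℝ H] [FiniteDimensional ℝ H] (L : E →L[ℝ] H) (hL : Function.Injective L) :
    ∃ A : H →L[ℝ] E, ∀ v, A (L v) = v := by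
  obtain ⟨A, hA⟩ := LinearMap.exists_leftInverse_of_injective (L : E →ₗ[ℝ] H)
    (LinearMap.ker_eq_bot.2 hL)
  exact ⟨A.toContinuousLinearMap, fun v => LinearMap.congr_fun hA v⟩

/-- An injective endomorphism of a finite-dimensional space is a continuous linear equivalence. -/
theorem exists_cle_of_injective (L : E →L[ℝ] E) (hL : Function.Injective L) :
    ∃ e : E ≃L[ℝ] E, (e : E →L[ℝ] E) = L :=
  ⟨(LinearEquiv.ofInjectiveEndo (L : E →ₗ[ℝ] E) hL).toContinuousLinearEquiv, by ext; rfl⟩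

/-- A map with injective derivative at a point has a smooth local left inverse there. -/
theorem exists_contDiffAt_leftInverse {f : E → H} {x₀ : E} (hf : ContDiffAt ℝ ∞ f x₀)
    (hinj : Function.Injective (fderiv ℝ f x₀)) :
    ∃ ρ : H → E, ContDiffAt ℝ ∞ ρ (f x₀) ∧ ∀ᶠ x in 𝓝 x₀, ρ (f x) = x := by
  obtain ⟨A, hA⟩ := exists_clm_leftInverse _ hinj
  -- `A ∘ f` has derivative the identity at `x₀`, so the inverse function theorem applies; its local
  -- inverse composed with `A` is `ρ`.
  have hg : ContDiffAt ℝ ∞ (fun x => A (f x)) x₀ := A.contDiff.contDiffAt.comp x₀ hf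
  have hd : HasFDerivAt (fun x => A (f x))
      ((ContinuousLinearEquiv.refl ℝ E : E ≃L[ℝ] E) : E →L[ℝ] E) x₀ := by
    have h := A.hasFDerivAt.comp x₀ (hf.differentiableAt (by simp)).hasFDerivAt
    convert! h using 1
    ext v
    simp [hA]
  have hn : (∞ : WithTop ℕ∞) ≠ 0 := by simp
  refine ⟨fun y => hg.localInverse hd hn (A y), ?_, ?_⟩
  · exact ContDiffAt.comp (f x₀) (hg.to_localInverse hd hn) A.contDiff.contDiffAt
  · exact (hg.hasStrictFDerivAt' hd hn).eventually_left_inverse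

/-- The image of a neighbourhood under a map with injective derivative has at least the dimension
of the source. -/
theorem finrank_le_dimH_image {f : E → H} {x₀ : E} (hf : ContDiffAt ℝ ∞ f x₀)
    (hinj : Function.Injective (fderiv ℝ f x₀)) {V : Set E} (hV : V ∈ 𝓝 x₀) :
    (finrank ℝ E : ENNReal) ≤ dimH (f '' V) := by
  obtain ⟨ρ, hρ, hρf⟩ := exists_contDiffAt_leftInverse hf hinj
  obtain ⟨K, s, hs, hK⟩ := (hρ.of_le (m := 1) (by simp)).exists_lipschitzOnWith
  -- On `V'` the left inverse recovers the points and is Lipschitz on the image; Lipschitz maps do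
  -- not raise Hausdorff dimension.
  set V' := V ∩ (f ⁻¹' s ∩ {x | ρ (f x) = x}) with hV'
  have hmem : V' ∈ 𝓝 x₀ :=
    inter_mem hV (inter_mem (hf.continuousAt.preimage_mem_nhds hs) hρf)
  have himg : V' ⊆ ρ '' (f '' V') := fun x hx => ⟨f x, mem_image_of_mem f hx, hx.2.2⟩
  have hsub : f '' V' ⊆ s := by
    rintro _ ⟨x, hx, rfl⟩
    exact hx.2.1
  calc (finrank ℝ E : ENNReal) = dimH V' := (Real.dimH_of_mem_nhds hmem).symm
    _ ≤ dimH (ρ '' (f '' V')) := dimH_mono himg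
    _ ≤ dimH (f '' V') := (hK.mono hsub).dimH_image_le
    _ ≤ dimH (f '' V) := dimH_mono (image_mono inter_subset_left)

/-- If the time derivative of a family of immersions is tangential, then in suitable coordinates
the family is locally independent of time. -/
theorem exists_straightening {f : E × ℝ → H} {Ω : Set (E × ℝ)} (hΩ : IsOpen Ω)
    (hf : ContDiffOn ℝ ∞ f Ω) {z₀ : E × ℝ} (hz₀ : z₀ ∈ Ω)
    (hinj : Function.Injective fun v : E => fderiv ℝ f z₀ (v, 0))
    (htan : ∀ z ∈ Ω, ∃ u : E, fderiv ℝ f z (u, 0) = fderiv ℝ f z (0, 1)) :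
    ∃ (Φ : OpenPartialHomeomorph (E × ℝ) (E × ℝ)) (A : H →L[ℝ] E) (r : ℝ), 0 < r ∧
      z₀ ∈ Φ.source ∧ Φ.source ⊆ Ω ∧ (∀ z, Φ z = (A (f z), z.2)) ∧
      Metric.ball (Φ z₀) r ⊆ Φ.target ∧
      ∀ y s t, (y, s) ∈ Metric.ball (Φ z₀) r → (y, t) ∈ Metric.ball (Φ z₀) r →
        f (Φ.symm (y, s)) = f (Φ.symm (y, t)) := by
  obtain ⟨A, hA⟩ := exists_clm_leftInverse
    ((fderiv ℝ f z₀).comp (ContinuousLinearMap.inl ℝ E ℝ)) hinj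
  have hfat : ∀ z ∈ Ω, ContDiffAt ℝ ∞ f z := fun z hz => hf.contDiffAt (hΩ.mem_nhds hz)
  -- `D z` is the derivative of the new coordinates `(A (f z), t)`. At `z₀` it is injective because
  -- `A` inverts the spatial derivative.
  set D : E × ℝ → ((E × ℝ) →L[ℝ] (E × ℝ)) := fun z =>
    (A.comp (fderiv ℝ f z)).prod (ContinuousLinearMap.snd ℝ E ℝ) with hD
  have hΨd : ∀ z ∈ Ω, HasFDerivAt (fun z => (A (f z), z.2)) (D z) z := fun z hz =>
    (A.hasFDerivAt.comp z ((hfat z hz).differentiableAt (by simp)).hasFDerivAt).prodMk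
      hasFDerivAt_snd
  have hΨ : ContDiffAt ℝ ∞ (fun z => (A (f z), z.2)) z₀ :=
    (A.contDiff.contDiffAt.comp z₀ (hfat z₀ hz₀)).prodMk contDiffAt_snd
  obtain ⟨e, he⟩ := exists_cle_of_injective (D z₀) (by
    rw [injective_iff_map_eq_zero]
    rintro ⟨v, s⟩ h
    have h2 : s = 0 := congrArg Prod.snd h
    have h1 : A (fderiv ℝ f z₀ (v, s)) = 0 := congrArg Prod.fst h
    subst h2
    have h3 : A (fderiv ℝ f z₀ (v, 0)) = v := hA v
    rw [← h3, h1]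
    rfl)
  have hDcont : ContinuousAt D z₀ := by
    have h : ContinuousAt (fderiv ℝ f) z₀ :=
      (hfat z₀ hz₀).continuousAt_fderiv (by simp)
    exact (ContinuousLinearMap.prodₗᵢ ℝ).continuous.continuousAt.comp
      (((ContinuousLinearMap.compL ℝ (E × ℝ) H E A).continuous.continuousAt.comp h).prodMk
        continuousAt_const)
  -- Invertibility is an open condition. It is needed on the whole domain, since the inverse is
  -- differentiated along an entire time segment.
  have hev : ∀ᶠ z in 𝓝 z₀, D z ∈ range ((↑) : ((E × ℝ) ≃L[ℝ] (E × ℝ)) → ((E × ℝ) →L[ℝ] (E × ℝ))) :=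
    hDcont.eventually (by rw [← he]; exact ContinuousLinearEquiv.nhds e)
  have hn : (∞ : WithTop ℕ∞) ≠ 0 := by simp
  obtain ⟨S, hSsub, hSo, hzS⟩ := mem_nhds_iff.1 (inter_mem hev (hΩ.mem_nhds hz₀))
  set Φ := (hΨ.toOpenPartialHomeomorph _ (he ▸ hΨd z₀ hz₀) hn).restrOpen S hSo with hΦ
  have hΦz : ∀ z, Φ z = (A (f z), z.2) := fun z => rfl
  have hz₀Φ : z₀ ∈ Φ.source :=
    ⟨hΨ.mem_toOpenPartialHomeomorph_source _ hn, hzS⟩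
  have hΦS : Φ.source ⊆ S := fun z hz => hz.2
  obtain ⟨r, hr, hball⟩ := Metric.isOpen_iff.1 Φ.open_target _ (Φ.map_source hz₀Φ)
  refine ⟨Φ, A, r, hr, hz₀Φ, fun z hz => (hSsub (hΦS hz)).2, hΦz, hball, fun y s t hs ht => ?_⟩
  have hder : ∀ s, (y, s) ∈ Metric.ball (Φ z₀) r →
      HasDerivAt (fun s => f (Φ.symm (y, s))) 0 s := by
    intro s hs
    have hz := Φ.map_target (hball hs)
    set z := Φ.symm (y, s) with hzdef
    obtain ⟨⟨e', he'⟩, hzΩ⟩ := hSsub (hΦS hz)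
    have h1 : HasFDerivAt Φ.symm (e'.symm : (E × ℝ) →L[ℝ] (E × ℝ)) (y, s) :=
      Φ.hasFDerivAt_symm (hball hs) (he' ▸ hΨd z hzΩ)
    have h2 : HasDerivAt (fun s => (y, s)) ((0 : E), (1 : ℝ)) s :=
      (hasDerivAt_const s y).prodMk (hasDerivAt_id s)
    have h3 := ((hfat z hzΩ).differentiableAt (by simp)).hasFDerivAt.comp_hasDerivAt s
      (h1.comp_hasDerivAt s h2)
    convert! h3 using 1
    -- `w` is the velocity of `s ↦ Φ.symm (y, s)`. Its time component is 1, so tangency lets `(w.1 +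
    -- u, 0)` replace it under the derivative of `f`. This spatial vector is killed by `D z`, hence
    -- is zero.
    set w := e'.symm (0, 1) with hw
    have hw' : D z w = (0, 1) := by rw [← he', hw]; exact e'.apply_symm_apply _
    have hw2 : w.2 = 1 := congrArg Prod.snd hw'
    have hw1 : A (fderiv ℝ f z w) = 0 := congrArg Prod.fst hw'
    obtain ⟨u, hu⟩ := htan z hzΩ
    have hsum : fderiv ℝ f z w = fderiv ℝ f z (w.1 + u, 0) := by
      have : w = (w.1, 0) + (0, 1) := by ext <;> simp [hw2]
      conv_lhs => rw [this]
      rw [map_add, ← hu, ← map_add]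
      simp
    have h0 : D z (w.1 + u, 0) = 0 := by
      ext
      · change A (fderiv ℝ f z (w.1 + u, 0)) = 0
        rw [← hsum, hw1]
      · rfl
    rw [← he'] at h0
    have h00 : (w.1 + u, (0 : ℝ)) = 0 := e'.map_eq_zero_iff.1 h0
    change 0 = fderiv ℝ f z w
    rw [hsum, h00, map_zero]
  have hset : ∀ s, (y, s) ∈ Metric.ball (Φ z₀) r → s ∈ Metric.ball (Φ z₀).2 r := by
    intro s hs
    rw [← Prod.mk.eta (p := Φ z₀), ← ball_prod_same] at hs
    exact hs.2
  have hyr : y ∈ Metric.ball (Φ z₀).1 r := by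
    rw [← Prod.mk.eta (p := Φ z₀), ← ball_prod_same] at hs
    exact hs.1
  have hset' : ∀ s ∈ Metric.ball (Φ z₀).2 r, (y, s) ∈ Metric.ball (Φ z₀) r := by
    intro s hs
    rw [← Prod.mk.eta (p := Φ z₀), ← ball_prod_same]
    exact ⟨hyr, hs⟩
  have hmv := (convex_ball (Φ z₀).2 r).norm_image_sub_le_of_norm_hasDerivWithin_le (C := 0)
    (fun s hs => (hder s (hset' s hs)).hasDerivWithinAt) (by simp) (hset s hs) (hset t ht)
  rw [zero_mul, norm_le_zero_iff, sub_eq_zero] at hmv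
  exact hmv.symm

/-- If the time derivative of a family of immersions is tangential, then its level sets are locally
graphs over the time axis. -/
theorem exists_levelCurves {f : E × ℝ → H} {Ω : Set (E × ℝ)} (hΩ : IsOpen Ω)
    (hf : ContDiffOn ℝ ∞ f Ω) {z₀ : E × ℝ} (hz₀ : z₀ ∈ Ω)
    (hinj : Function.Injective fun v : E => fderiv ℝ f z₀ (v, 0))
    (htan : ∀ z ∈ Ω, ∃ u : E, fderiv ℝ f z (u, 0) = fderiv ℝ f z (0, 1)) :
    ∃ U : Set (E × ℝ), IsOpen U ∧ z₀ ∈ U ∧ U.InjOn (fun z => (f z, z.2)) ∧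
      ∃ r > 0, ∃ σ : (E × ℝ) × ℝ → E, ContinuousOn σ (U ×ˢ Ioo (z₀.2 - r) (z₀.2 + r)) ∧
        ∀ z ∈ U, z.2 ∈ Ioo (z₀.2 - r) (z₀.2 + r) ∧ σ (z, z.2) = z.1 ∧
          ∀ s ∈ Ioo (z₀.2 - r) (z₀.2 + r), (σ (z, s), s) ∈ Ω ∧ f (σ (z, s), s) = f z := by
  obtain ⟨Φ, A, r, hr, hz₀Φ, hΦΩ, hΦ, hball, hconst⟩ :=
    exists_straightening hΩ hf hz₀ hinj htan
  set B := Metric.ball (Φ z₀) r with hB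
  have hsplit : ∀ y s, (y, s) ∈ B ↔ y ∈ Metric.ball (A (f z₀)) r ∧
      s ∈ Ioo (z₀.2 - r) (z₀.2 + r) := fun y s => by
    rw [hB, hΦ z₀, ← ball_prod_same, Real.ball_eq_Ioo]
    rfl
  have hUB : ∀ z ∈ Φ.source ∩ Φ ⁻¹' B, (A (f z), z.2) ∈ B := fun z hz => hΦ z ▸ hz.2
  have hUs : ∀ z ∈ Φ.source ∩ Φ ⁻¹' B, ∀ s ∈ Ioo (z₀.2 - r) (z₀.2 + r), (A (f z), s) ∈ B :=
    fun z hz s hs => (hsplit _ _).2 ⟨((hsplit _ _).1 (hUB z hz)).1, hs⟩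
  -- `σ` keeps the coordinate `A (f z)` and changes only the time. Injectivity is immediate because
  -- `Φ` is a function of `f` and the time.
  refine ⟨Φ.source ∩ Φ ⁻¹' B, Φ.isOpen_inter_preimage Metric.isOpen_ball,
    ⟨hz₀Φ, Metric.mem_ball_self hr⟩, fun z hz z' hz' h => ?_, r, hr,
    fun w => (Φ.symm (A (f w.1), w.2)).1, ?_, fun z hz => ⟨((hsplit _ _).1 (hUB z hz)).2, ?_,
      fun s hs => ?_⟩⟩
  · refine Φ.injOn hz.1 hz'.1 ?_
    have h1 : f z = f z' := congrArg Prod.fst h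
    have h2 : z.2 = z'.2 := (Prod.ext_iff.1 h).2
    rw [hΦ, hΦ, h1, h2]
  · have h1 : ContinuousOn (fun w : (E × ℝ) × ℝ => (A (f w.1), w.2))
        ((Φ.source ∩ Φ ⁻¹' B) ×ˢ Ioo (z₀.2 - r) (z₀.2 + r)) :=
      (A.continuous.comp_continuousOn (hf.continuousOn.comp continuousOn_fst
        fun w hw => hΦΩ hw.1.1)).prodMk continuousOn_snd
    exact continuous_fst.comp_continuousOn
      (Φ.continuousOn_symm.comp h1 fun w hw => hball (hUs _ hw.1 _ hw.2))
  · change (Φ.symm (A (f z), z.2)).1 = z.1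
    rw [← hΦ, Φ.left_inv hz.1]
  · have hsB := hUs z hz s hs
    have h2 : (Φ.symm (A (f z), s)).2 = s := by
      have := Φ.right_inv (hball hsB)
      rw [hΦ] at this
      exact congrArg Prod.snd this
    have h3 : ((Φ.symm (A (f z), s)).1, s) = Φ.symm (A (f z), s) := Prod.ext rfl h2.symm
    refine ⟨?_, ?_⟩
    · rw [h3]
      exact hΦΩ (Φ.map_target (hball hsB))
    · rw [h3, hconst _ _ _ hsB (hUB z hz), ← hΦ, Φ.left_inv hz.1]

end Flat

/-! ### Level curves over the time axis and continuous global transport along them. -/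

section Transport

variable {M H : Type*} [TopologicalSpace M]

/-- On `s`, the curve `t ↦ (γ t, t)` is continuous and stays in the level set `G = x`. -/
def IsLevelCurveOn (G : M × ℝ → H) (x : H) (γ : ℝ → M) (s : Set ℝ) : Prop :=
  ContinuousOn γ s ∧ ∀ t ∈ s, G (γ t, t) = x

/-- Near every point, the level sets of `G` are graphs of curves over the time axis that depend
continuously on the point. -/
def HasLevelCurves (G : M × ℝ → H) : Prop :=
  ∀ z₀ : M × ℝ, ∃ W ∈ 𝓝 z₀, ∃ ε > 0, ∃ σ : (M × ℝ) × ℝ → M,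
    ContinuousOn σ (W ×ˢ Ioo (z₀.2 - ε) (z₀.2 + ε)) ∧
    ∀ z ∈ W, z.2 ∈ Ioo (z₀.2 - ε) (z₀.2 + ε) ∧ σ (z, z.2) = z.1 ∧
      ∀ s ∈ Ioo (z₀.2 - ε) (z₀.2 + ε), G (σ (z, s), s) = G z

variable {G : M × ℝ → H} {x : H} {γ γ' : ℝ → M}

theorem IsLevelCurveOn.mono {s t : Set ℝ} (h : IsLevelCurveOn G x γ t) (hst : s ⊆ t) :
    IsLevelCurveOn G x γ s :=
  ⟨h.1.mono hst, fun r hr => h.2 r (hst hr)⟩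

/-- Both `t ↦ (γ t, t)` and `t ↦ (γ' t, t)` lift `t ↦ (x, t)` through a locally injective map, so
uniqueness of lifts on preconnected sets applies. -/
theorem IsLevelCurveOn.eqOn [T2Space M]
    (hinj : IsLocallyInjective fun z : M × ℝ => (G z, z.2)) {s : Set ℝ} (hs : IsPreconnected s)
    (h : IsLevelCurveOn G x γ s) (h' : IsLevelCurveOn G x γ' s) {a : ℝ} (ha : a ∈ s)
    (haa : γ a = γ' a) : EqOn γ γ' s := by
  have := (T2Space.isSeparatedMap fun z : M × ℝ => (G z, z.2)).eqOn_of_comp_eqOn hinj hs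
    (h.1.prodMk continuousOn_id) (h'.1.prodMk continuousOn_id)
    (fun t ht => by simp [h.2 t ht, h'.2 t ht]) ha (by simp [haa])
  exact fun t ht => congrArg Prod.fst (this ht)

/-- Level curves on adjacent intervals can be glued. -/
theorem IsLevelCurveOn.glue {a b c : ℝ} (hab : a ≤ b) (hbc : b ≤ c)
    (h : IsLevelCurveOn G x γ (Icc a b)) (h' : IsLevelCurveOn G x γ' (Icc b c))
    (hb : γ b = γ' b) :
    ∃ η, IsLevelCurveOn G x η (Icc a c) ∧ EqOn η γ (Icc a b) ∧ EqOn η γ' (Icc b c) := by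
  set η : ℝ → M := fun t => if t ≤ b then γ t else γ' t with hη
  have h1 : EqOn η γ (Icc a b) := fun t ht => if_pos ht.2
  have h2 : EqOn η γ' (Icc b c) := fun t ht => by
    rcases ht.1.eq_or_lt with rfl | hlt
    · simp [hη, hb]
    · simp [hη, not_le.2 hlt]
  refine ⟨η, ⟨?_, fun t ht => ?_⟩, h1, h2⟩
  · rw [← Icc_union_Icc_eq_Icc hab hbc]
    exact (h.1.congr h1).union_of_isClosed (h'.1.congr h2) isClosed_Icc isClosed_Icc
  · rcases le_total t b with htb | htb
    · rw [h1 ⟨ht.1, htb⟩]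
      exact h.2 t ⟨ht.1, htb⟩
    · rw [h2 ⟨htb, ht.2⟩]
      exact h'.2 t ⟨htb, ht.2⟩

/-- Level curves through the points of a compact set exist for a uniform time. -/
theorem HasLevelCurves.exists_uniform (hG : HasLevelCurves G) {K : Set (M × ℝ)}
    (hK : IsCompact K) : ∃ δ > 0, ∀ z ∈ K, ∃ γ : ℝ → M,
      IsLevelCurveOn G (G z) γ (Icc (z.2 - δ) (z.2 + δ)) ∧ γ z.2 = z.1 := by
  refine hK.induction_on (p := fun K => ∃ δ > 0, ∀ z ∈ K, ∃ γ : ℝ → M,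
    IsLevelCurveOn G (G z) γ (Icc (z.2 - δ) (z.2 + δ)) ∧ γ z.2 = z.1)
    ⟨1, one_pos, by simp⟩ (fun s t hst ht => ?_) (fun s t hs ht => ?_) (fun z₀ _ => ?_)
  · obtain ⟨δ, hδ, h⟩ := ht
    exact ⟨δ, hδ, fun z hz => h z (hst hz)⟩
  · obtain ⟨δ, hδ, h⟩ := hs
    obtain ⟨δ', hδ', h'⟩ := ht
    refine ⟨min δ δ', lt_min hδ hδ', ?_⟩
    rintro z (hz | hz)
    · obtain ⟨γ, hγ, hγz⟩ := h z hz
      exact ⟨γ, hγ.mono (Icc_subset_Icc (by linarith [min_le_left δ δ'])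
        (by linarith [min_le_left δ δ'])), hγz⟩
    · obtain ⟨γ, hγ, hγz⟩ := h' z hz
      exact ⟨γ, hγ.mono (Icc_subset_Icc (by linarith [min_le_right δ δ'])
        (by linarith [min_le_right δ δ'])), hγz⟩
  · obtain ⟨W, hW, ε, hε, σ, hσ, h⟩ := hG z₀
    refine ⟨W ∩ Prod.snd ⁻¹' Ioo (z₀.2 - ε / 2) (z₀.2 + ε / 2), mem_nhdsWithin_of_mem_nhds
      (inter_mem hW (continuous_snd.continuousAt.preimage_mem_nhds
        (Ioo_mem_nhds (by linarith) (by linarith)))), ε / 2, by linarith, fun z hz => ?_⟩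
    have hsub : Icc (z.2 - ε / 2) (z.2 + ε / 2) ⊆ Ioo (z₀.2 - ε) (z₀.2 + ε) := fun t ht =>
      ⟨by linarith [ht.1, hz.2.1], by linarith [ht.2, hz.2.2]⟩
    obtain ⟨-, h2, h3⟩ := h z hz.1
    refine ⟨fun s => σ (z, s), ⟨?_, fun t ht => h3 t (hsub ht)⟩, h2⟩
    exact hσ.comp (by fun_prop) fun t ht => ⟨hz.1, hsub ht⟩

/-- If the level sets of `G` are compact over compact time intervals, then level curves exist over
all compact time intervals. -/
theorem HasLevelCurves.exists_Icc (hG : HasLevelCurves G)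
    (hK : ∀ x a b, IsCompact {z : M × ℝ | G z = x ∧ z.2 ∈ Icc a b}) (z : M × ℝ) {a b : ℝ}
    (hz : z.2 ∈ Icc a b) :
    ∃ γ : ℝ → M, IsLevelCurveOn G (G z) γ (Icc a b) ∧ γ z.2 = z.1 := by
  obtain ⟨δ, hδ, h⟩ := hG.exists_uniform (hK (G z) a b)
  -- The interval grows by `δ` on each side at every step. Clipping to `[a, b]` keeps both endpoints
  -- in the compact level set, where the same `δ` is available again; for `n = 0` the interval is a
  -- single point.
  have key : ∀ n : ℕ, ∃ γ : ℝ → M,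
      IsLevelCurveOn G (G z) γ (Icc (max a (z.2 - n * δ)) (min b (z.2 + n * δ))) ∧
        γ z.2 = z.1 := by
    intro n
    induction n with
    | zero =>
      refine ⟨fun _ => z.1, ⟨continuousOn_const, fun t ht => ?_⟩, rfl⟩
      have : t = z.2 := le_antisymm (by simpa using ht.2.trans (min_le_right _ _))
        (by simpa using (le_max_right _ _).trans ht.1)
      simp [this]
    | succ n ih =>
      obtain ⟨γ, hγ, hγz⟩ := ih
      have hnδ : 0 ≤ n * δ := by positivity
      set a' := max a (z.2 - n * δ) with ha'
      set b' := min b (z.2 + n * δ) with hb'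
      have haz : a' ≤ z.2 := max_le hz.1 (by linarith)
      have hzb : z.2 ≤ b' := le_min hz.2 (by linarith)
      have hab' : a' ≤ b' := haz.trans hzb
      have hmem : ∀ t ∈ Icc a' b', (γ t, t) ∈ {w : M × ℝ | G w = G z ∧ w.2 ∈ Icc a b} :=
        fun t ht => ⟨hγ.2 t ht, (le_max_left _ _).trans ht.1, ht.2.trans (min_le_left _ _)⟩
      obtain ⟨γr, hγr, hr⟩ := h _ (hmem b' ⟨hab', le_rfl⟩)
      obtain ⟨γl, hγl, hl⟩ := h _ (hmem a' ⟨le_rfl, hab'⟩)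
      rw [hγ.2 _ ⟨hab', le_rfl⟩] at hγr
      rw [hγ.2 _ ⟨le_rfl, hab'⟩] at hγl
      obtain ⟨η, hη, hη1, -⟩ := hγ.glue hab' (by linarith : b' ≤ b' + δ)
        (hγr.mono (Icc_subset_Icc (by simp; linarith) le_rfl)) hr.symm
      obtain ⟨θ, hθ, -, hθ2⟩ := (hγl.mono (Icc_subset_Icc le_rfl (by simp; linarith))).glue
        (by linarith : a' - δ ≤ a') (by linarith : a' ≤ b' + δ) hη
        (hl.trans (hη1 ⟨le_rfl, hab'⟩).symm)
      refine ⟨θ, hθ.mono (Icc_subset_Icc ?_ ?_), ?_⟩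
      · rw [ha', sub_le_iff_le_add]
        refine max_le (by linarith [le_max_left a (z.2 - (n + 1 : ℕ) * δ)]) ?_
        have := le_max_right a (z.2 - (n + 1 : ℕ) * δ)
        push_cast at this ⊢
        linarith
      · rw [hb', ← sub_le_iff_le_add]
        refine le_min (by linarith [min_le_left b (z.2 + (n + 1 : ℕ) * δ)]) ?_
        have := min_le_right b (z.2 + (n + 1 : ℕ) * δ)
        push_cast at this ⊢
        linarith
      · rw [hθ2 ⟨haz, by linarith⟩, hη1 ⟨haz, hzb⟩, hγz]
  obtain ⟨n, hn⟩ := exists_nat_ge ((b - a) / δ)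
  obtain ⟨γ, hγ, hγz⟩ := key n
  rw [div_le_iff₀ hδ] at hn
  refine ⟨γ, hγ.mono (Icc_subset_Icc (max_le le_rfl ?_) (le_min le_rfl ?_)), hγz⟩
  · linarith [hz.2]
  · linarith [hz.1]

/-- Curves on growing compact intervals around `z.2` agree by uniqueness, so they patch to a curve
on all of `ℝ`. -/
theorem HasLevelCurves.exists_univ [T2Space M] (hG : HasLevelCurves G)
    (hinj : IsLocallyInjective fun z : M × ℝ => (G z, z.2))
    (hK : ∀ x a b, IsCompact {z : M × ℝ | G z = x ∧ z.2 ∈ Icc a b}) (z : M × ℝ) :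
    ∃ γ : ℝ → M, IsLevelCurveOn G (G z) γ univ ∧ γ z.2 = z.1 := by
  have hex : ∀ m : ℕ, ∃ γ : ℝ → M,
      IsLevelCurveOn G (G z) γ (Icc (z.2 - m) (z.2 + m)) ∧ γ z.2 = z.1 := fun m =>
    hG.exists_Icc hK z ⟨by linarith [m.cast_nonneg (α := ℝ)], by linarith [m.cast_nonneg (α := ℝ)]⟩
  choose γ hγ hγz using hex
  have hmono : ∀ m k : ℕ, m ≤ k → EqOn (γ m) (γ k) (Icc (z.2 - m) (z.2 + m)) := fun m k hmk => by
    have hmk' : (m : ℝ) ≤ k := by exact_mod_cast hmk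
    have hm0 := m.cast_nonneg (α := ℝ)
    exact (hγ m).eqOn hinj isPreconnected_Icc
      ((hγ k).mono (Icc_subset_Icc (by linarith) (by linarith)))
      (a := z.2) ⟨by linarith, by linarith⟩ (by rw [hγz, hγz])
  have hself : ∀ s, s ∈ Icc (z.2 - ⌈|s - z.2|⌉₊) (z.2 + ⌈|s - z.2|⌉₊) := fun s => by
    have := abs_le.1 (Nat.le_ceil |s - z.2|)
    exact ⟨by linarith [this.1], by linarith [this.2]⟩
  set η : ℝ → M := fun s => γ ⌈|s - z.2|⌉₊ s with hη
  have hηγ : ∀ m : ℕ, EqOn η (γ m) (Icc (z.2 - m) (z.2 + m)) := fun m s hs => by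
    refine hmono _ m (Nat.ceil_le.2 (abs_le.2 ⟨by linarith [hs.1], by linarith [hs.2]⟩)) (hself s)
  refine ⟨η, ⟨fun s _ => ?_, fun s _ => (hγ _).2 s (hself s)⟩, hγz _⟩
  -- The extra 1 puts `s` in the interior of the interval, as continuity at `s` requires.
  set m := ⌈|s - z.2|⌉₊ + 1 with hm
  have hnhds : Icc (z.2 - m) (z.2 + m) ∈ 𝓝 s := by
    have := hself s
    refine Icc_mem_nhds ?_ ?_ <;> rw [hm] <;> push_cast
    · linarith [this.1]
    · linarith [this.2]
  exact (((hγ m).1.congr (hηγ m)).continuousAt hnhds).continuousWithinAt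

/-- Transport along the level curves is globally defined and continuous. -/
theorem HasLevelCurves.exists_transport [T2Space M] (hG : HasLevelCurves G)
    (hinj : IsLocallyInjective fun z : M × ℝ => (G z, z.2))
    (hK : ∀ x a b, IsCompact {z : M × ℝ | G z = x ∧ z.2 ∈ Icc a b}) :
    ∃ T : (M × ℝ) × ℝ → M, Continuous T ∧ (∀ z, T (z, z.2) = z.1) ∧
      (∀ z s, G (T (z, s), s) = G z) ∧ ∀ z s r, T ((T (z, s), s), r) = T (z, r) := by
  choose T hT hTz using hG.exists_univ hinj hK
  have hTG : ∀ z s, G (T z s, s) = G z := fun z s => (hT z).2 s trivial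
  have hTc : ∀ z, Continuous (T z) := fun z => continuousOn_univ.1 (hT z).1
  have hcocycle : ∀ z s r, T (T z s, s) r = T z r := fun z s r => by
    have h := hT (T z s, s)
    rw [hTG] at h
    exact h.eqOn hinj isPreconnected_univ (hT z) (a := s) trivial (hTz (T z s, s)) trivial
  refine ⟨fun w => T w.1 w.2, ?_, hTz, hTG, hcocycle⟩
  -- Near the diagonal, uniqueness identifies `T` with the continuous local family `σ`.
  have hbox : ∀ z₁ : M × ℝ, ∃ W ∈ 𝓝 z₁, ∃ ε > 0, ContinuousOn (fun w : (M × ℝ) × ℝ => T w.1 w.2)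
      (W ×ˢ Ioo (z₁.2 - ε) (z₁.2 + ε)) := by
    intro z₁
    obtain ⟨W, hW, ε, hε, σ, hσ, h⟩ := hG z₁
    refine ⟨W, hW, ε, hε, hσ.congr ?_⟩
    rintro ⟨z, s⟩ ⟨hz, hs⟩
    obtain ⟨h1, h2, h3⟩ := h z hz
    have hc : IsLevelCurveOn G (G z) (fun s => σ (z, s)) (Ioo (z₁.2 - ε) (z₁.2 + ε)) :=
      ⟨hσ.comp (by fun_prop) fun t ht => ⟨hz, ht⟩, h3⟩
    exact ((hT z).mono (subset_univ _)).eqOn hinj isPreconnected_Ioo hc h1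
      ((hTz z).trans h2.symm) hs
  rw [continuous_iff_continuousAt]
  rintro ⟨z₀, s₀⟩
  -- A connectedness argument along the level curve through `z₀`: the times near which transport is
  -- continuous form a clopen set containing `z₀.2`.
  set S : Set ℝ := {s | ∀ᶠ w in 𝓝 (z₀, s), ContinuousAt (fun w : (M × ℝ) × ℝ => T w.1 w.2) w}
  suffices h : S = univ from (h ▸ mem_univ s₀ : s₀ ∈ S).self_of_nhds
  have hSo : IsOpen S := by
    rw [isOpen_iff_mem_nhds]
    intro s hs
    exact (Continuous.continuousAt (f := fun s : ℝ => (z₀, s)) (by fun_prop)).eventually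
      (eventually_eventually_nhds.2 hs)
  refine IsClopen.eq_univ ⟨?_, hSo⟩ ⟨z₀.2, ?_⟩
  · refine isClosed_of_closure_subset fun s₁ hs₁ => ?_
    -- For a limit time `s₁`, stop at a nearby good time `s₂`: by the cocycle identity `T` is
    -- transport to `s₂`, continuous since `s₂ ∈ S`, followed by a short transport inside the box
    -- around `(T z₀ s₁, s₁)`.
    obtain ⟨W, hW, ε, hε, hcont⟩ := hbox (T z₀ s₁, s₁)
    have hnear : ∀ᶠ s in 𝓝 s₁, (T z₀ s, s) ∈ interior W ∧ s ∈ Ioo (s₁ - ε) (s₁ + ε) :=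
      ((((hTc z₀).prodMk continuous_id).continuousAt).eventually_mem
        (isOpen_interior.mem_nhds (mem_interior_iff_mem_nhds.2 hW))).and
        (Ioo_mem_nhds (by linarith) (by linarith))
    obtain ⟨s₂, ⟨hs₂W, hs₂⟩, hs₂S⟩ := mem_closure_iff_nhds.1 hs₁ _ hnear
    have hev : ∀ᶠ z in 𝓝 z₀, (T z s₂, s₂) ∈ interior W ∧
        ContinuousAt (fun z => T z s₂) z := by
      have hc : ∀ᶠ z in 𝓝 z₀, ContinuousAt (fun z => T z s₂) z := by
        have := (Continuous.continuousAt (f := fun z : M × ℝ => (z, s₂)) (x := z₀)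
          (by fun_prop)).eventually hs₂S
        filter_upwards [this] with z hz
        exact ContinuousAt.comp (f := fun z : M × ℝ => (z, s₂)) hz (by fun_prop)
      exact ((hc.self_of_nhds.prodMk continuousAt_const).eventually_mem
        (isOpen_interior.mem_nhds hs₂W)).and hc
    have hev2 : ∀ᶠ w : (M × ℝ) × ℝ in 𝓝 (z₀, s₁), ((T w.1 s₂, s₂) ∈ interior W ∧
        ContinuousAt (fun z => T z s₂) w.1) ∧ w.2 ∈ Ioo (s₁ - ε) (s₁ + ε) := by
      rw [nhds_prod_eq]
      exact hev.prod_mk (Ioo_mem_nhds (by linarith) (by linarith))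
    change ∀ᶠ w in 𝓝 (z₀, s₁), _
    filter_upwards [hev2] with w hw
    have h1 : ContinuousAt (fun w : (M × ℝ) × ℝ => ((T w.1 s₂, s₂), w.2)) w :=
      ((ContinuousAt.comp (f := Prod.fst) hw.1.2 continuousAt_fst).prodMk
        continuousAt_const).prodMk continuousAt_snd
    have h2 : ContinuousAt (fun w : (M × ℝ) × ℝ => T w.1 w.2) ((T w.1 s₂, s₂), w.2) :=
      hcont.continuousAt (prod_mem_nhds (mem_interior_iff_mem_nhds.1 hw.1.1)
        (isOpen_Ioo.mem_nhds hw.2))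
    have h3 := ContinuousAt.comp (f := fun w : (M × ℝ) × ℝ => ((T w.1 s₂, s₂), w.2)) h2 h1
    refine h3.congr (Eventually.of_forall fun w => ?_)
    exact hcocycle w.1 s₂ w.2
  · obtain ⟨W, hW, ε, hε, hcont⟩ := hbox z₀
    refine eventually_of_mem (prod_mem_nhds (interior_mem_nhds.2 hW)
      (Ioo_mem_nhds (a := z₀.2 - ε) (b := z₀.2 + ε) (by linarith) (by linarith))) fun w hw => ?_
    exact hcont.continuousAt (prod_mem_nhds (mem_interior_iff_mem_nhds.1 hw.1)
      (isOpen_Ioo.mem_nhds hw.2))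

end Transport

/-! ### Families of immersions of a manifold: compact level sets, charts, lifts and dimension. -/

section Manifold

variable {n N : ℕ} {M : Type*} [TopologicalSpace M] [ChartedSpace (EuclideanSpace ℝ (Fin n)) M]

/-- A time-dependent family of maps, read in the preferred chart at `p`. -/
def spacetimeRep (G : M → ℝ → EuclideanSpace ℝ (Fin N)) (p : M)
    (z : EuclideanSpace ℝ (Fin n) × ℝ) : EuclideanSpace ℝ (Fin N) :=
  G ((extChartAt (𝓡 n) p).symm z.1) z.2

/-- A smooth family, over all times, of immersions. -/
structure IsImmersionFamily (G : M → ℝ → EuclideanSpace ℝ (Fin N)) : Prop where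
  smooth : ContMDiff ((𝓡 n).prod 𝓘(ℝ, ℝ)) (𝓡 N) ∞ (fun q : M × ℝ => G q.1 q.2)
  immersion : ∀ t p, Function.Injective (differential (n := n) (fun q => G q t) p)

/-- The family moves tangentially. -/
def IsTangential (G : M → ℝ → EuclideanSpace ℝ (Fin N)) : Prop :=
  ∀ t p, deriv (G p) t ∈ LinearMap.range (differential (n := n) (fun q => G q t) p).toLinearMap

namespace IsImmersionFamily

variable {G : M → ℝ → EuclideanSpace ℝ (Fin N)}

theorem contMDiff_slice (hG : IsImmersionFamily (n := n) G) (t : ℝ) :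
    ContMDiff (𝓡 n) (𝓡 N) ∞ (fun q => G q t) :=
  hG.smooth.comp (contMDiff_id.prodMk contMDiff_const)

theorem isOpen_spacetime_target (p : M) :
    IsOpen ((extChartAt (𝓡 n) p).target ×ˢ (univ : Set ℝ)) :=
  (isOpen_extChartAt_target p).prod isOpen_univ

theorem hasDerivAt (hG : IsImmersionFamily (n := n) G) (p : M) (t : ℝ) :
    HasDerivAt (G p) (deriv (G p) t) t := by
  have h : ContMDiff 𝓘(ℝ, ℝ) (𝓡 N) ∞ (fun s : ℝ => G p s) :=
    hG.smooth.comp (contMDiff_const.prodMk contMDiff_id)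
  exact (h.contDiff.differentiable (by simp) t).hasDerivAt

/-- If the speed is bounded in terms of the position, properness of one map gives compactness of
the level sets over compact time intervals. -/
theorem isCompact_levelSet (hG : IsImmersionFamily (n := n) G)
    (hproper : IsProperMap (fun q => G q 0)) {K : ℝ}
    (hK : ∀ t p, ‖deriv (G p) t‖ ≤ K * ‖G p t‖) (x : EuclideanSpace ℝ (Fin N)) (a b : ℝ) :
    IsCompact {z : M × ℝ | G z.1 z.2 = x ∧ z.2 ∈ Icc a b} := by
  -- Gronwall is run from time `t` towards time 0, which for `t ≥ 0` means reversing time; this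
  -- bounds the position at time 0, where properness is known.
  have hpos : ∀ p t, 0 ≤ t → ‖G p 0‖ ≤ ‖G p t‖ * Real.exp (K * t) := by
    intro p t ht
    have hd : ∀ s, HasDerivAt (fun s => G p (t - s)) (-(deriv (G p) (t - s))) s := fun s => by
      simpa using (hG.hasDerivAt p (t - s)).comp_const_sub t s
    have := norm_le_gronwallBound_of_norm_deriv_right_le (f := fun s => G p (t - s)) (a := 0)
      (b := t) (δ := ‖G p t‖) (K := K) (ε := 0)
      (fun s _ => (hd s).continuousAt.continuousWithinAt) (fun s _ => (hd s).hasDerivWithinAt)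
      (by simp) (fun s _ => by simpa using hK (t - s) p) t ⟨ht, le_rfl⟩
    simpa [gronwallBound_ε0] using this
  have hneg : ∀ p t, t ≤ 0 → ‖G p 0‖ ≤ ‖G p t‖ * Real.exp (K * (-t)) := by
    intro p t ht
    have := norm_le_gronwallBound_of_norm_deriv_right_le (f := G p) (a := t)
      (b := 0) (δ := ‖G p t‖) (K := K) (ε := 0)
      (fun s _ => (hG.hasDerivAt p s).continuousAt.continuousWithinAt)
      (fun s _ => (hG.hasDerivAt p s).hasDerivWithinAt)
      le_rfl (fun s _ => by simpa using hK s p) 0 ⟨ht, le_rfl⟩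
    simpa [gronwallBound_ε0] using this
  set R := ‖x‖ * Real.exp (|K| * (|a| + |b|)) with hR
  have hbound : ∀ p t, G p t = x → t ∈ Icc a b → ‖G p 0‖ ≤ R := by
    rintro p t rfl ht
    have habs : |t| ≤ |a| + |b| := by
      rw [abs_le]
      constructor
      · linarith [ht.1, neg_abs_le a, abs_nonneg b]
      · linarith [ht.2, le_abs_self b, abs_nonneg a]
    have hexp : ‖G p 0‖ ≤ ‖G p t‖ * Real.exp (K * |t|) := by
      rcases le_total 0 t with h | h
      · rw [abs_of_nonneg h]
        exact hpos p t h
      · rw [abs_of_nonpos h]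
        exact hneg p t h
    refine hexp.trans (mul_le_mul_of_nonneg_left (Real.exp_le_exp.2 ?_) (norm_nonneg _))
    exact (mul_le_mul_of_nonneg_right (le_abs_self K) (abs_nonneg t)).trans
      (mul_le_mul_of_nonneg_left habs (abs_nonneg K))
  have hcomp : IsCompact (((fun q => G q 0) ⁻¹' Metric.closedBall 0 R) ×ˢ Icc a b) :=
    (hproper.isCompact_preimage (isCompact_closedBall 0 R)).prod isCompact_Icc
  refine hcomp.of_isClosed_subset ?_ fun z hz => ⟨by simpa using hbound _ _ hz.1 hz.2, hz.2⟩
  exact (isClosed_singleton.preimage hG.smooth.continuous).inter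
    (isClosed_Icc.preimage continuous_snd)

end IsImmersionFamily

variable [IsManifold (𝓡 n) ∞ M]

/-- In a chart, the derivative of `g` is its differential up to an isomorphism. -/
theorem exists_hasFDerivAt_comp_extChartAt_symm {g : M → EuclideanSpace ℝ (Fin N)} (p : M)
    {x : EuclideanSpace ℝ (Fin n)} (hx : x ∈ (extChartAt (𝓡 n) p).target)
    (hg : MDifferentiableAt (𝓡 n) (𝓡 N) g ((extChartAt (𝓡 n) p).symm x)) :
    ∃ D : EuclideanSpace ℝ (Fin n) ≃L[ℝ] EuclideanSpace ℝ (Fin n),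
      HasFDerivAt (fun y => g ((extChartAt (𝓡 n) p).symm y))
        ((differential (n := n) g ((extChartAt (𝓡 n) p).symm x)).comp (D : _ →L[ℝ] _)) x := by
  have : IsManifold (𝓡 n) 1 M := IsManifold.of_le (n := ∞) (by simp)
  obtain ⟨D, hD⟩ := isInvertible_mfderivWithin_extChartAt_symm (I := 𝓡 n) hx
  refine ⟨D, ?_⟩
  have h1 := (mdifferentiableWithinAt_extChartAt_symm (I := 𝓡 n) hx).hasMFDerivWithinAt
  rw [← hD] at h1
  have h2 := hg.hasMFDerivAt.comp_hasMFDerivWithinAt x h1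
  rw [ModelWithCorners.range_eq_univ, hasMFDerivWithinAt_univ] at h2
  exact h2.hasFDerivAt

theorem contDiffOn_comp_extChartAt_symm {g : M → EuclideanSpace ℝ (Fin N)}
    (hg : ContMDiff (𝓡 n) (𝓡 N) ∞ g) (p : M) :
    ContDiffOn ℝ ∞ (fun y => g ((extChartAt (𝓡 n) p).symm y)) (extChartAt (𝓡 n) p).target :=
  contMDiffOn_iff_contDiffOn.1 (hg.comp_contMDiffOn (contMDiffOn_extChartAt_symm p))

/-- A continuous lift of a smooth map through an immersion is smooth. -/
theorem contMDiffAt_of_comp_immersion {E' H' X : Type*} [NormedAddCommGroup E'] [NormedSpace ℝ E']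
    [TopologicalSpace H'] {J : ModelWithCorners ℝ E' H'} [TopologicalSpace X] [ChartedSpace H' X]
    {g : M → EuclideanSpace ℝ (Fin N)} (hg : ContMDiff (𝓡 n) (𝓡 N) ∞ g) {ξ : X → M} {z : X}
    (hinj : Function.Injective (differential (n := n) g (ξ z))) (hξ : ContinuousAt ξ z)
    (hgξ : ContMDiffAt J (𝓡 N) ∞ (fun w => g (ξ w)) z) : ContMDiffAt J (𝓡 n) ∞ ξ z := by
  set φ := extChartAt (𝓡 n) (ξ z) with hφ
  have hsrc : ξ z ∈ φ.source := mem_extChartAt_source (ξ z)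
  have htgt : φ (ξ z) ∈ φ.target := φ.map_source hsrc
  have hopen : IsOpen φ.target := isOpen_extChartAt_target (ξ z)
  have hf := (contDiffOn_comp_extChartAt_symm hg (ξ z)).contDiffAt (hopen.mem_nhds htgt)
  obtain ⟨D, hD⟩ := exists_hasFDerivAt_comp_extChartAt_symm (ξ z) htgt
    (hg.mdifferentiable (by simp) _)
  rw [← hφ, φ.left_inv hsrc] at hD
  obtain ⟨ρ, hρ, hρf⟩ := exists_contDiffAt_leftInverse hf (by
    rw [hD.fderiv]
    exact hinj.comp D.injective)
  rw [← hφ] at hρf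
  simp only [← hφ, φ.left_inv hsrc] at hρ
  -- In the chart, `ξ` is `ρ ∘ (g ∘ ξ)` near `z`; continuity of `ξ` keeps it in the region where `ρ`
  -- inverts `g`.
  have hcoord : ContMDiffAt J (𝓡 n) ∞ (fun w => ρ (g (ξ w))) z :=
    ContMDiffAt.comp (f := fun w => g (ξ w)) z hρ.contMDiffAt hgξ
  have hρz : ρ (g (ξ z)) = φ (ξ z) := by
    simpa only [φ.left_inv hsrc] using hρf.self_of_nhds
  have hsymm : ContMDiffAt (𝓡 n) (𝓡 n) ∞ φ.symm (ρ (g (ξ z))) := by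
    rw [hρz]
    exact (contMDiffOn_extChartAt_symm (ξ z)).contMDiffAt (hopen.mem_nhds htgt)
  refine (ContMDiffAt.comp z hsymm hcoord).congr_of_eventuallyEq ?_
  have h1 : ∀ᶠ w in 𝓝 z, ξ w ∈ φ.source :=
    hξ.eventually_mem ((isOpen_extChartAt_source (ξ z)).mem_nhds hsrc)
  have h2 : ∀ᶠ w in 𝓝 z, ρ (g (φ.symm (φ (ξ w)))) = φ (ξ w) :=
    ((continuousAt_extChartAt (I := 𝓡 n) (ξ z)).comp hξ).eventually hρf
  filter_upwards [h1, h2] with w hw1 hw2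
  rw [φ.left_inv hw1] at hw2
  simp [hw2, φ.left_inv hw1]

namespace IsImmersionFamily

variable {G : M → ℝ → EuclideanSpace ℝ (Fin N)}

theorem contDiffOn_spacetimeRep (hG : IsImmersionFamily (n := n) G) (p : M) :
    ContDiffOn ℝ ∞ (spacetimeRep (n := n) G p) ((extChartAt (𝓡 n) p).target ×ˢ univ) := by
  rw [← contMDiffOn_iff_contDiffOn]
  refine hG.smooth.comp_contMDiffOn (ContMDiffOn.prodMk ?_ contDiff_snd.contMDiff.contMDiffOn)
  exact (contMDiffOn_extChartAt_symm p).comp contDiff_fst.contMDiff.contMDiffOn fun z hz => hz.1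

/-- Splits the spacetime derivative into space and time directions, to carry injectivity and
tangency between manifold and chart. The isomorphism `D` is the derivative of the inverse chart. -/
theorem exists_fderiv_spacetimeRep (hG : IsImmersionFamily (n := n) G) (p : M)
    {z : EuclideanSpace ℝ (Fin n) × ℝ} (hz : z.1 ∈ (extChartAt (𝓡 n) p).target) :
    (∃ D : EuclideanSpace ℝ (Fin n) ≃L[ℝ] EuclideanSpace ℝ (Fin n), ∀ v,
      fderiv ℝ (spacetimeRep (n := n) G p) z (v, 0) =
        differential (n := n) (fun q => G q z.2) ((extChartAt (𝓡 n) p).symm z.1) (D v)) ∧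
      fderiv ℝ (spacetimeRep (n := n) G p) z (0, 1) =
        deriv (G ((extChartAt (𝓡 n) p).symm z.1)) z.2 := by
  have hd : HasFDerivAt (spacetimeRep (n := n) G p)
      (fderiv ℝ (spacetimeRep (n := n) G p) (z.1, z.2)) (z.1, z.2) :=
    (((hG.contDiffOn_spacetimeRep p).contDiffAt
      ((isOpen_spacetime_target p).mem_nhds ⟨hz, trivial⟩)).differentiableAt
        (by simp)).hasFDerivAt
  constructor
  · obtain ⟨D, hD⟩ := exists_hasFDerivAt_comp_extChartAt_symm p hz
      ((hG.contMDiff_slice z.2).mdifferentiable (by simp) _)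
    refine ⟨D, fun v => ?_⟩
    have h : HasFDerivAt (fun y => G ((extChartAt (𝓡 n) p).symm y) z.2) _ z.1 :=
      HasFDerivAt.comp (g := spacetimeRep (n := n) G p) (f := fun y => (y, z.2)) z.1 hd
        (hasFDerivAt_prodMk_left z.1 z.2)
    replace h := h.unique hD
    exact DFunLike.congr_fun h v
  · have h2 : HasDerivAt (fun s => (z.1, s)) ((0 : EuclideanSpace ℝ (Fin n)), (1 : ℝ)) z.2 :=
      (hasDerivAt_const z.2 z.1).prodMk (hasDerivAt_id z.2)
    exact (hd.comp_hasDerivAt z.2 h2).deriv.symm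

theorem hasLevelCurves_and_isLocallyInjective (hG : IsImmersionFamily (n := n) G)
    (htan : IsTangential (n := n) G) :
    HasLevelCurves (fun z : M × ℝ => G z.1 z.2) ∧
      IsLocallyInjective (fun z : M × ℝ => (G z.1 z.2, z.2)) := by
  have key : ∀ z₀ : M × ℝ, ∃ W ∈ 𝓝 z₀, (∃ ε > 0, ∃ σ : (M × ℝ) × ℝ → M,
      ContinuousOn σ (W ×ˢ Ioo (z₀.2 - ε) (z₀.2 + ε)) ∧
      ∀ z ∈ W, z.2 ∈ Ioo (z₀.2 - ε) (z₀.2 + ε) ∧ σ (z, z.2) = z.1 ∧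
        ∀ s ∈ Ioo (z₀.2 - ε) (z₀.2 + ε), G (σ (z, s)) s = G z.1 z.2) ∧
      W.InjOn (fun z : M × ℝ => (G z.1 z.2, z.2)) := by
    rintro ⟨p, t₀⟩
    set φ := extChartAt (𝓡 n) p with hφ
    have hsrc : p ∈ φ.source := mem_extChartAt_source p
    have htgt : φ p ∈ φ.target := φ.map_source hsrc
    obtain ⟨U, hU, hzU, hinj, r, hr, σ, hσ, h⟩ := exists_levelCurves
      (isOpen_spacetime_target p) (hG.contDiffOn_spacetimeRep p) (z₀ := (φ p, t₀))
      ⟨htgt, trivial⟩ (by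
        obtain ⟨⟨D, hD⟩, -⟩ := hG.exists_fderiv_spacetimeRep p (z := (φ p, t₀)) htgt
        simp only [hD]
        exact (hG.immersion _ _).comp D.injective) (by
        intro z hz
        obtain ⟨⟨D, hD⟩, h2⟩ := hG.exists_fderiv_spacetimeRep p hz.1
        obtain ⟨u, hu⟩ := htan z.2 (φ.symm z.1)
        refine ⟨D.symm u, ?_⟩
        rw [hD, h2, D.apply_symm_apply]
        exact hu)
    set c : M × ℝ → EuclideanSpace ℝ (Fin n) × ℝ := fun z => (φ z.1, z.2) with hc
    have hcc : ContinuousOn c (φ.source ×ˢ univ) :=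
      ((continuousOn_extChartAt p).comp continuousOn_fst fun z hz => hz.1).prodMk continuousOn_snd
    have hfc : ∀ z : M × ℝ, z.1 ∈ φ.source →
        spacetimeRep (n := n) G p (c z) = G z.1 z.2 := fun z hz => by
      change G (φ.symm (φ z.1)) z.2 = _
      rw [φ.left_inv hz]
    have hWo : IsOpen ((φ.source ×ˢ univ) ∩ c ⁻¹' U) := hcc.isOpen_inter_preimage
      ((isOpen_extChartAt_source p).prod isOpen_univ) hU
    refine ⟨_, hWo.mem_nhds ⟨⟨hsrc, trivial⟩, hzU⟩,
      ⟨r, hr, fun w => φ.symm (σ (c w.1, w.2)), ?_, fun z hz => ⟨(h _ hz.2).1, ?_, ?_⟩⟩, ?_⟩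
    · have h1 : ContinuousOn (fun w : (M × ℝ) × ℝ => (c w.1, w.2))
          (((φ.source ×ˢ univ) ∩ c ⁻¹' U) ×ˢ Ioo (t₀ - r) (t₀ + r)) :=
        (hcc.comp continuousOn_fst fun w hw => hw.1.1).prodMk continuousOn_snd
      exact (continuousOn_extChartAt_symm p).comp (hσ.comp h1 fun w hw => ⟨hw.1.2, hw.2⟩)
        fun w hw => (((h _ hw.1.2).2.2 _ hw.2).1).1
    · change φ.symm (σ (c z, (c z).2)) = z.1
      rw [(h _ hz.2).2.1]
      exact φ.left_inv hz.1.1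
    · intro s hs
      rw [← hfc z hz.1.1]
      exact ((h _ hz.2).2.2 s hs).2
    · intro z hz z' hz' hzz
      have h1 : c z = c z' := hinj hz.2 hz'.2 (by
        simp only [hfc z hz.1.1, hfc z' hz'.1.1]
        exact hzz)
      exact Prod.ext (φ.injOn hz.1.1 hz'.1.1 (congrArg Prod.fst h1)) (Prod.ext_iff.1 hzz).2
  refine ⟨fun z₀ => ?_, isLocallyInjective_iff_nhds.2 fun z₀ => ?_⟩
  · obtain ⟨W, hW, h, -⟩ := key z₀
    exact ⟨W, hW, h⟩
  · obtain ⟨W, hW, -, h⟩ := key z₀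
    exact ⟨W, hW, h⟩

/-- If all the maps have the same image, the family moves tangentially: otherwise the image would
contain an immersed manifold of dimension `n + 1`. -/
theorem isTangential_of_range_eq [SecondCountableTopology M]
    (hG : IsImmersionFamily (n := n) G)
    (hrange : ∀ t, range (fun q => G q t) = range (fun q => G q 0)) :
    IsTangential (n := n) G := by
  intro t₀ p
  by_contra hnot
  set φ := extChartAt (𝓡 n) p with hφ
  have htgt : φ p ∈ φ.target := φ.map_source (mem_extChartAt_source p)
  have hsymm : φ.symm (φ p) = p := φ.left_inv (mem_extChartAt_source p)
  obtain ⟨⟨D, hD⟩, h2⟩ := hG.exists_fderiv_spacetimeRep p (z := (φ p, t₀)) htgt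
  simp only [← hφ, hsymm] at hD h2
  -- A kernel vector with nonzero time component would express the velocity as a tangential vector,
  -- against `hnot`.
  have hinj : Function.Injective (fderiv ℝ (spacetimeRep (n := n) G p) (φ p, t₀)) := by
    rw [injective_iff_map_eq_zero]
    rintro ⟨v, s⟩ h
    have hsum : fderiv ℝ (spacetimeRep (n := n) G p) (φ p, t₀) (v, s) =
        differential (n := n) (fun q => G q t₀) p (D v) + s • deriv (G p) t₀ := by
      have : (v, s) = (v, 0) + s • ((0 : EuclideanSpace ℝ (Fin n)), (1 : ℝ)) := by ext <;> simp
      rw [this, map_add, map_smul, hD, h2]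
    rw [hsum] at h
    by_cases hs : s = 0
    · subst hs
      rw [zero_smul, add_zero] at h
      have := hG.immersion t₀ p (h.trans (map_zero _).symm)
      have hv : v = 0 := D.map_eq_zero_iff.1 this
      rw [hv]
      rfl
    · refine (hnot ⟨-(s⁻¹ • D v), ?_⟩).elim
      have h' := eq_neg_of_add_eq_zero_right h
      change differential (n := n) (fun q => G q t₀) p (-(s⁻¹ • D v)) = _
      rw [map_neg, map_smul, ← smul_neg, ← h', smul_smul, inv_mul_cancel₀ hs, one_smul]
  have hlow := finrank_le_dimH_image ((hG.contDiffOn_spacetimeRep p).contDiffAt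
    ((isOpen_spacetime_target p).mem_nhds ⟨htgt, trivial⟩)) hinj univ_mem
  have hup : dimH (range fun q => G q 0) ≤ n := by
    obtain ⟨s, hs, hcover⟩ := countable_cover_nhds
      (fun q : M => extChartAt_source_mem_nhds (I := 𝓡 n) q)
    have hsub : range (fun q => G q 0) ⊆ ⋃ q ∈ s,
        (fun y => G ((extChartAt (𝓡 n) q).symm y) 0) '' (extChartAt (𝓡 n) q).target := by
      rintro _ ⟨x, rfl⟩
      obtain ⟨q, hq, hx⟩ := mem_iUnion₂.1 (hcover ▸ mem_univ x : x ∈ ⋃ q ∈ s, _)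
      refine mem_iUnion₂.2 ⟨q, hq, extChartAt (𝓡 n) q x, (extChartAt (𝓡 n) q).map_source hx, ?_⟩
      simp only [(extChartAt (𝓡 n) q).left_inv hx]
    refine (dimH_mono hsub).trans ?_
    rw [dimH_bUnion hs]
    refine iSup₂_le fun q _ => ?_
    refine (dimH_image_le_of_locally_lipschitzOn fun y hy => ?_).trans
      ((dimH_mono (subset_univ _)).trans (by simp [Real.dimH_univ_eq_finrank]))
    have hc := (contDiffOn_comp_extChartAt_symm (hG.contMDiff_slice 0) q).contDiffAt
      ((isOpen_extChartAt_target q).mem_nhds hy)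
    obtain ⟨C, u, hu, hC⟩ := (hc.of_le (m := 1) (by simp)).exists_lipschitzOnWith
    exact ⟨C, u, mem_nhdsWithin_of_mem_nhds hu, hC⟩
  -- No restriction to the chart target is needed: `φ.symm` takes values in `M` everywhere.
  have himg : spacetimeRep (n := n) G p '' univ ⊆ range (fun q => G q 0) := by
    rintro _ ⟨z, -, rfl⟩
    rw [← hrange z.2]
    exact ⟨φ.symm z.1, rfl⟩
  have := hlow.trans ((dimH_mono himg).trans hup)
  rw [finrank_prod, finrank_self, finrank_euclideanSpace_fin] at this
  have h' : n + 1 ≤ n := by exact_mod_cast this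
  omega

end IsImmersionFamily

end Manifold

/-! ### The rescaled mean curvature flow and its self-similarity. -/

section Flow

/-- The rescaled flow `e^(τ/2) F(p, -e^(-τ))`. -/
def rescaledFlow {N : ℕ} {M : Type*} (F : M → ℝ → EuclideanSpace ℝ (Fin N)) (p : M) (τ : ℝ) :
    EuclideanSpace ℝ (Fin N) :=
  Real.exp (τ / 2) • F p (-Real.exp (-τ))

theorem rescaledFlow_zero {N : ℕ} {M : Type*} (F : M → ℝ → EuclideanSpace ℝ (Fin N)) (p : M) : rescaledFlow F p 0 = F p (-1) := by
  simp [rescaledFlow]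

theorem sqrt_neg_smul_rescaledFlow {N : ℕ} {M : Type*} (F : M → ℝ → EuclideanSpace ℝ (Fin N))
    {t : ℝ} (ht : t < 0) (p : M) :
    √(-t) • rescaledFlow F p (-Real.log (-t)) = F p t := by
  have h : √(-t) * Real.exp (-Real.log (-t) / 2) = 1 := by
    rw [neg_div, Real.exp_neg, Real.exp_half, Real.exp_log (neg_pos.2 ht)]
    exact mul_inv_cancel₀ (Real.sqrt_pos.2 (neg_pos.2 ht)).ne'
  rw [rescaledFlow, smul_smul, h, one_smul, neg_neg, Real.exp_log (neg_pos.2 ht), neg_neg]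

variable {n N : ℕ} {M : Type*} [TopologicalSpace M] [ChartedSpace (EuclideanSpace ℝ (Fin n)) M]

/-- The component of `v` normal to `f` vanishes if and only if `v` is tangential. -/
theorem normalPart_eq_zero_iff (f : M → EuclideanSpace ℝ (Fin N)) (p : M)
    (v : EuclideanSpace ℝ (Fin N)) :
    normalPart (n := n) f p v = 0 ↔
      v ∈ LinearMap.range (differential (n := n) f p).toLinearMap := by
  rw [normalPart, Submodule.starProjection_apply_eq_zero_iff, Submodule.orthogonal_orthogonal]

theorem meanCurvature_mem_orthogonal (f : M → EuclideanSpace ℝ (Fin N)) (p : M) :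
    meanCurvature (n := n) f p ∈
      (LinearMap.range (differential (n := n) f p).toLinearMap)ᗮ :=
  Submodule.sum_mem _ fun _ _ => Submodule.sum_mem _ fun _ _ => Submodule.smul_mem _ _
    (Submodule.starProjection_apply_mem _ _)

theorem normalPart_meanCurvature (f : M → EuclideanSpace ℝ (Fin N)) (p : M) :
    normalPart (n := n) f p (meanCurvature (n := n) f p) = meanCurvature (n := n) f p :=
  Submodule.starProjection_eq_self_iff.2 (meanCurvature_mem_orthogonal f p)

theorem differential_const_smul {f : M → EuclideanSpace ℝ (Fin N)} {p : M}
    (hf : MDifferentiableAt (𝓡 n) (𝓡 N) f p) (c : ℝ) :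
    differential (n := n) (fun q => c • f q) p = c • differential (n := n) f p :=
  (hf.hasMFDerivAt.const_smul c).mfderiv

variable {F : M → ℝ → EuclideanSpace ℝ (Fin N)}

theorem IsMeanCurvatureFlow.contMDiff_slice (hF : IsMeanCurvatureFlow n F) {t : ℝ} (ht : t < 0) :
    ContMDiff (𝓡 n) (𝓡 N) ∞ (fun q => F q t) :=
  hF.smooth.comp_contMDiff (contMDiff_id.prodMk contMDiff_const) fun _ => ⟨trivial, ht⟩

theorem IsMeanCurvatureFlow.differential_rescaledFlow (hF : IsMeanCurvatureFlow n F) (τ : ℝ)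
    (p : M) : differential (n := n) (fun q => rescaledFlow F q τ) p =
      Real.exp (τ / 2) • differential (n := n) (fun q => F q (-Real.exp (-τ))) p :=
  differential_const_smul ((hF.contMDiff_slice
    (neg_lt_zero.2 (Real.exp_pos _))).mdifferentiable (by simp) p) _

theorem IsMeanCurvatureFlow.range_differential_rescaledFlow (hF : IsMeanCurvatureFlow n F)
    (τ : ℝ) (p : M) :
    LinearMap.range (differential (n := n) (fun q => rescaledFlow F q τ) p).toLinearMap =
      LinearMap.range (differential (n := n) (fun q => F q (-Real.exp (-τ))) p).toLinearMap := by
  rw [hF.differential_rescaledFlow]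
  exact LinearMap.range_smul _ _ (Real.exp_ne_zero _)

theorem IsMeanCurvatureFlow.isImmersionFamily (hF : IsMeanCurvatureFlow n F) :
    IsImmersionFamily (n := n) (rescaledFlow F) where
  smooth := by
    have h1 : ContMDiff ((𝓡 n).prod 𝓘(ℝ, ℝ)) 𝓘(ℝ, ℝ) ∞ fun q : M × ℝ => -Real.exp (-q.2) :=
      ContMDiff.comp (g := fun s : ℝ => -Real.exp (-s))
        (contDiff_neg.exp.neg).contMDiff contMDiff_snd
    have h2 : ContMDiff ((𝓡 n).prod 𝓘(ℝ, ℝ)) 𝓘(ℝ, ℝ) ∞ fun q : M × ℝ => Real.exp (q.2 / 2) :=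
      ContMDiff.comp (g := fun s : ℝ => Real.exp (s / 2))
        (contDiff_id.div_const 2).exp.contMDiff contMDiff_snd
    exact h2.smul (hF.smooth.comp_contMDiff (contMDiff_fst.prodMk h1)
      fun _ => ⟨trivial, neg_lt_zero.2 (Real.exp_pos _)⟩)
  immersion t p := by
    rw [hF.differential_rescaledFlow]
    intro v w h
    exact hF.immersion _ (neg_lt_zero.2 (Real.exp_pos _)) p
      (smul_right_injective _ (Real.exp_ne_zero (t / 2)) h)

theorem IsMeanCurvatureFlow.deriv_rescaledFlow (hF : IsMeanCurvatureFlow n F) (p : M) (τ : ℝ) :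
    deriv (rescaledFlow F p) τ = Real.exp (τ / 2) • ((1 / 2 : ℝ) • F p (-Real.exp (-τ)) +
      Real.exp (-τ) • meanCurvature (n := n) (fun q => F q (-Real.exp (-τ))) p) := by
  have h1 : HasDerivAt (fun s : ℝ => -Real.exp (-s)) (Real.exp (-τ)) τ := by
    have h := (hasDerivAt_neg τ).exp.fun_neg
    rwa [mul_neg_one, neg_neg] at h
  have h2 : HasDerivAt (fun s : ℝ => Real.exp (s / 2)) (Real.exp (τ / 2) * (1 / 2)) τ :=
    ((hasDerivAt_id τ).div_const 2).exp
  have h3 := (hF.flow _ (neg_lt_zero.2 (Real.exp_pos (-τ))) p).scomp τ h1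
  have h4 := (h2.smul h3).deriv
  refine h4.trans ?_
  simp only [Function.comp_apply, smul_add, smul_smul]
  rw [add_comm]

/-- The shrinker equation holds if and only if the rescaled flow moves tangentially. -/
theorem IsMeanCurvatureFlow.isTangential_rescaledFlow_iff (hF : IsMeanCurvatureFlow n F) :
    IsTangential (n := n) (rescaledFlow F) ↔
      ∀ t < 0, ∀ p : M, meanCurvature (n := n) (fun q => F q t) p =
        (1 / (2 * t)) • normalPart (n := n) (fun q => F q t) p (F p t) := by
  have key : ∀ τ p, deriv (rescaledFlow F p) τ ∈ LinearMap.range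
      (differential (n := n) (fun q => rescaledFlow F q τ) p).toLinearMap ↔
      meanCurvature (n := n) (fun q => F q (-Real.exp (-τ))) p = (1 / (2 * -Real.exp (-τ))) •
        normalPart (n := n) (fun q => F q (-Real.exp (-τ))) p (F p (-Real.exp (-τ))) := by
    intro τ p
    have he := Real.exp_ne_zero (-τ)
    rw [hF.range_differential_rescaledFlow, ← normalPart_eq_zero_iff, hF.deriv_rescaledFlow]
    have hlin : ∀ (c a b : ℝ) (v w : EuclideanSpace ℝ (Fin N)),
        normalPart (n := n) (fun q => F q (-Real.exp (-τ))) p (c • (a • v + b • w)) =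
        c • (a • normalPart (n := n) (fun q => F q (-Real.exp (-τ))) p v +
          b • normalPart (n := n) (fun q => F q (-Real.exp (-τ))) p w) := by
      intro c a b v w
      simp only [normalPart, map_smul, map_add]
    rw [hlin, normalPart_meanCurvature, smul_eq_zero_iff_right (Real.exp_ne_zero _)]
    set X := normalPart (n := n) (fun q => F q (-Real.exp (-τ))) p (F p (-Real.exp (-τ)))
    set Y := meanCurvature (n := n) (fun q => F q (-Real.exp (-τ))) p
    have hcoef : (1 / (2 * -Real.exp (-τ))) = -((Real.exp (-τ))⁻¹ * (1 / 2)) := by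
      field_simp
    -- The factor `Real.exp (-τ)`, nonzero, clears the denominator in the shrinker equation.
    rw [hcoef, neg_smul, mul_smul, eq_neg_iff_add_eq_zero, ← smul_eq_zero_iff_right (m := Y + _) he,
      smul_add, smul_inv_smul₀ he, add_comm]
  constructor
  · intro h t ht p
    have := (key (-Real.log (-t)) p).1 (h _ p)
    rwa [neg_neg, Real.exp_log (neg_pos.2 ht), neg_neg] at this
  · exact fun h τ p => (key τ p).2 (h _ (neg_lt_zero.2 (Real.exp_pos _)) p)

/-- The velocity `d` is half the position plus a multiple of `H`. If `d` is tangential, pairing with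
`d` removes `H`, and Cauchy–Schwarz bounds `‖d‖²` by `‖d‖` times half the norm of the position. No
curvature bound enters. -/
theorem IsMeanCurvatureFlow.norm_deriv_rescaledFlow_le (hF : IsMeanCurvatureFlow n F)
    (htan : IsTangential (n := n) (rescaledFlow F)) (τ : ℝ) (p : M) :
    ‖deriv (rescaledFlow F p) τ‖ ≤ 1 / 2 * ‖rescaledFlow F p τ‖ := by
  have hd := htan τ p
  have hderiv := hF.deriv_rescaledFlow p τ
  rw [hF.range_differential_rescaledFlow] at hd
  set d := deriv (rescaledFlow F p) τ
  set Y := meanCurvature (n := n) (fun q => F q (-Real.exp (-τ))) p with hY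
  have hdY : inner ℝ d Y = 0 :=
    (Submodule.mem_orthogonal _ _).1 (meanCurvature_mem_orthogonal _ p) d hd
  have hd' : d = (1 / 2 : ℝ) • rescaledFlow F p τ + (Real.exp (τ / 2) * Real.exp (-τ)) • Y := by
    rw [hderiv, rescaledFlow, smul_add, smul_smul, smul_smul, smul_smul, mul_comm (1 / 2 : ℝ)]
  have hsq : ‖d‖ * ‖d‖ = 1 / 2 * inner ℝ d (rescaledFlow F p τ) := by
    rw [← real_inner_self_eq_norm_mul_norm]
    nth_rewrite 2 [hd']
    rw [inner_add_right, inner_smul_right, inner_smul_right, hdY, mul_zero, add_zero]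
  rcases (norm_nonneg d).eq_or_lt with h0 | hpos
  · rw [← h0]
    positivity
  · refine le_of_mul_le_mul_left ?_ hpos
    rw [hsq]
    linarith [real_inner_le_norm d (rescaledFlow F p τ)]

theorem ImageSelfSimilar.range_rescaledFlow {N : ℕ} {M : Type*}
    {F : M → ℝ → EuclideanSpace ℝ (Fin N)} (h : ImageSelfSimilar F) (τ : ℝ) :
    range (fun q => rescaledFlow F q τ) = range (fun q => rescaledFlow F q 0) := by
  have h1 := h (-Real.exp (-τ)) (neg_lt_zero.2 (Real.exp_pos _))
  have h2 : range (fun q => rescaledFlow F q τ) =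
      (fun x => Real.exp (τ / 2) • x) '' range (fun p => F p (-Real.exp (-τ))) := by
    rw [← range_comp]
    rfl
  have h3 : Real.exp (τ / 2) * √(Real.exp (-τ)) = 1 := by
    rw [← Real.exp_half, ← Real.exp_add]
    simp [neg_div]
  rw [h2, h1, image_image]
  simp only [smul_smul, neg_neg, h3, one_smul, image_id', rescaledFlow_zero]

theorem ParamSelfSimilar.imageSelfSimilar (h : ParamSelfSimilar n F) : ImageSelfSimilar F := by
  obtain ⟨φ, -, hφ⟩ := h
  intro t ht
  rw [← range_comp, ← (φ t).surjective.range_comp ((fun x => √(-t) • x) ∘ fun p => F p (-1))]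
  exact congrArg range (funext fun p => hφ t ht p)

/-- A tangentially moving rescaled flow is stationary up to reparametrisation. -/
theorem IsMeanCurvatureFlow.paramSelfSimilar [T2Space M] [IsManifold (𝓡 n) ∞ M]
    (hF : IsMeanCurvatureFlow n F) (hproper : IsProperMap (fun p => F p (-1)))
    (htan : IsTangential (n := n) (rescaledFlow F)) : ParamSelfSimilar n F := by
  have hG := hF.isImmersionFamily
  obtain ⟨hlevel, hinj⟩ := hG.hasLevelCurves_and_isLocallyInjective htan
  obtain ⟨T, hTc, hTself, hTG, hTT⟩ := hlevel.exists_transport hinj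
    (hG.isCompact_levelSet (by simpa only [rescaledFlow_zero] using hproper)
      (hF.norm_deriv_rescaledFlow_le htan))
  have hsmooth : ContMDiff ((𝓡 n).prod 𝓘(ℝ, ℝ)) (𝓡 n) ∞ fun q : M × ℝ => T (q, 0) := fun q =>
    contMDiffAt_of_comp_immersion (g := fun q => rescaledFlow F q 0) (hG.contMDiff_slice 0)
      (hG.immersion 0 _) (hTc.comp (by fun_prop)).continuousAt
      ((hG.smooth q).congr_of_eventuallyEq (Eventually.of_forall fun w => hTG w 0))
  have hinv : ∀ τ, ContMDiff (𝓡 n) (𝓡 n) ∞ fun p => T ((p, 0), τ) := fun τ p =>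
    contMDiffAt_of_comp_immersion (g := fun q => rescaledFlow F q τ) (hG.contMDiff_slice τ)
      (hG.immersion τ _)
      (Continuous.continuousAt (f := fun p => T ((p, 0), τ)) (hTc.comp (by fun_prop)))
      ((hG.contMDiff_slice 0 p).congr_of_eventuallyEq
        (Eventually.of_forall fun w => hTG (w, 0) τ))
  -- With `τ = -log (-t)`, the diffeomorphism is transport from `τ` to 0, and its inverse is
  -- transport from 0 to `τ`; the cocycle identity makes them inverse to each other.
  refine ⟨fun t => ⟨⟨fun p => T ((p, -Real.log (-t)), 0), fun p => T ((p, 0), -Real.log (-t)),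
    fun p => ?_, fun p => ?_⟩, ?_, hinv _⟩, ?_, fun t ht p => ?_⟩
  · simp only [hTT]
    exact hTself (p, -Real.log (-t))
  · simp only [hTT]
    exact hTself (p, 0)
  · exact hsmooth.comp (contMDiff_id.prodMk contMDiff_const)
  · refine hsmooth.comp_contMDiffOn (contMDiffOn_fst.prodMk ?_)
    have hlog : ContMDiffOn 𝓘(ℝ, ℝ) 𝓘(ℝ, ℝ) ∞ (fun t : ℝ => -Real.log (-t)) (Iio 0) :=
      (contDiffOn_id.neg.log fun t ht => (neg_pos.2 ht).ne').neg.contMDiffOn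
    exact hlog.comp contMDiffOn_snd fun q hq => hq.2
  · have h := hTG (p, -Real.log (-t)) 0
    simp only [rescaledFlow_zero] at h
    change F p t = √(-t) • F (T ((p, -Real.log (-t)), 0)) (-1)
    rw [h, sqrt_neg_smul_rescaledFlow F ht]

end Flow

end MCF
end

theorem mainTheorem8 (n k : ℕ) {M : Type*} [TopologicalSpace M] [T2Space M]
    [SecondCountableTopology M] [ChartedSpace (EuclideanSpace ℝ (Fin n)) M]
    [IsManifold (𝓡 n) ∞ M] (F : M → ℝ → EuclideanSpace ℝ (Fin (n + k)))
    (hF : MCF.IsMeanCurvatureFlow n F)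
    (hproper : ∀ t < 0, IsProperMap (fun p => F p t)) :
    (MCF.ImageSelfSimilar F ↔
      ∀ t < 0, ∀ p : M, MCF.meanCurvature (n := n) (fun q => F q t) p =
        (1 / (2 * t)) • MCF.normalPart (n := n) (fun q => F q t) p (F p t)) ∧
    (MCF.ParamSelfSimilar n F ↔
      ∀ t < 0, ∀ p : M, MCF.meanCurvature (n := n) (fun q => F q t) p =
        (1 / (2 * t)) • MCF.normalPart (n := n) (fun q => F q t) p (F p t)) := by
  rw [← hF.isTangential_rescaledFlow_iff]
  have himage : MCF.ImageSelfSimilar F → MCF.IsTangential (n := n) (MCF.rescaledFlow F) :=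
    fun h => hF.isImmersionFamily.isTangential_of_range_eq h.range_rescaledFlow
  have hparam : MCF.IsTangential (n := n) (MCF.rescaledFlow F) → MCF.ParamSelfSimilar n F :=
    hF.paramSelfSimilar (hproper (-1) (by norm_num))
  exact ⟨⟨himage, fun h => (hparam h).imageSelfSimilar⟩,
    ⟨fun h => himage h.imageSelfSimilar, hparam⟩⟩
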